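/- Let $H$ be a separable, infinite-dimensional complex Hilbert space, let $T$ be a bounded linear operator on $H$, and let $K$ be a compact linear operator on $H$ such that the spectrum of $T+K$ is $\sigma(T+K)=\{0\}$ (so that $T+K+I$ is invertible). Suppose that for some integer $r\ge 0$ and some complex number $\lambda\neq 0$, $$\|(T+K+I)^n+\lambda (T+K+I)^{-n}\|=O(n^r)\qquad (n\to+\infty).$$ Then $(T+K)^{r+4}=0$. Moreover, $T$ is polynomially compact, that is, $p(T)$ is compact for some nonzero complex polynomial $p$; and $T$ is intransitive, that is, there is a closed linear subspace $M$ of $H$ with $M\neq\{0\}$, $M\neq H$ and $TM\subset M$. -/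

import Mathlib

open Filter Asymptotics Polynomial

/-- A bounded operator `T` is intransitive if it leaves invariant some closed linear subspace
other than `{0}` and the whole space. -/
def IsIntransitive {H : Type*} [NormedAddCommGroup H] [InnerProductSpace ℂ H]
    (T : H →L[ℂ] H) : Prop :=
  ∃ M : Submodule ℂ H, IsClosed (M : Set H) ∧ M ≠ ⊥ ∧ M ≠ ⊤ ∧ ∀ x ∈ M, T x ∈ M

/-- A bounded operator `T` is polynomially compact if `p(T)` is compact for some nonzero complex
polynomial `p`. -/
def IsPolynomiallyCompact {H : Type*} [NormedAddCommGroup H] [InnerProductSpace ℂ H]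
    (T : H →L[ℂ] H) : Prop :=
  ∃ p : ℂ[X], p ≠ 0 ∧ IsCompactOperator (aeval T p : H →L[ℂ] H)

/-!
Write `T + K = N` and `V = (1 + N)⁻¹`. The spectral hypothesis says that `1 - c • N` is invertible
for every complex `c`.

*Nilpotency.* Squaring `(1 + N) ^ n + lam • V ^ n` and comparing with the term of index `2 * n`
eliminates `lam`: `(1 + N) ^ (2 * n) + V ^ (2 * n)` also has polynomial growth. After replacing
`1 + N` by its square, one may thus take `lam = 1`. The generating function `∑ t ^ n • Xₙ` of
`Xₙ = (1 + N) ^ n + V ^ n` is, at `t = (s - 1) / (s + 1)`, equal to `1 + s • G s`, where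
`G s = (1 - ((s ^ 2 - 1) / 4) • S)⁻¹` and `S = N ^ 2 * V`
(`one_sub_smul_mul_tsum_sub_one`). The growth of `Xₙ` bounds `s • G s` for `0 < s.re` by
`(1 + ‖s‖) ^ (2 * m) / s.re ^ m`. Now `G` is entire, as `N` is quasinilpotent, and even, so the bound
holds on both sides of the imaginary axis. The maximum principle then removes the blow-up along that
axis (`norm_le_of_norm_mul_abs_re_pow_le`), and Liouville's theorem makes `S`, hence `N`, nilpotent
(`isNilpotent_of_norm_pow_add_pow_le`).

*Index.* When `N ^ (d + 1) = 0`, the product `N ^ (d - j) * ((1 + N) ^ n + lam • V ^ n)` is a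
polynomial in `n` whose coefficient of `n ^ j` is `(1 + lam * (-1) ^ j) / j !` times `N ^ d`. For
`j > r` the growth hypothesis kills this coefficient, and the scalar is nonzero for one of
`j = r + 1`, `j = r + 2`. So the index descends to `r + 2` (`pow_add_two_eq_zero_of_isBigO`).

*Invariant subspaces.* `T ^ (r + 4)` differs from `(T + K) ^ (r + 4) = 0` by a compact operator, so
it is compact and commutes with `T`. If it vanishes, `T` is nilpotent and has a nontrivial kernel
(or is `0`); otherwise Lomonosov's theorem applies, in the form proved here by Hilden's argument
(`IsIntransitive.of_commute_of_isCompactOperator`).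
-/

/-! ### Entire functions bounded away from the imaginary axis -/

/-- An entire function whose growth is polynomial except for a blow-up of finite order along the
imaginary axis has polynomial growth. -/
theorem norm_le_of_norm_mul_abs_re_pow_le {E : Type*} [NormedAddCommGroup E] [NormedSpace ℂ E]
    {h : ℂ → E} (hd : Differentiable ℂ h) {m : ℕ} {C : ℝ} (hC : 0 ≤ C)
    (hb : ∀ s : ℂ, ‖h s‖ * |s.re| ^ m ≤ C * (1 + ‖s‖) ^ (2 * m)) {s : ℂ} (hs : 1 ≤ ‖s‖) :
    ‖h s‖ ≤ C * (12 * ‖s‖) ^ m := by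
  set ρ : ℝ := 2 * ‖s‖ with hρ
  have hρ0 : 0 < ρ := by linarith
  -- On the circle `‖z‖ = ρ` one has `z ^ 2 + ρ ^ 2 = 2 * z * z.re`, which absorbs the blow-up.
  have key : ‖((s ^ 2 + (ρ : ℂ) ^ 2) ^ m) • h s‖ ≤ C * (2 * ρ) ^ m * (1 + ρ) ^ (2 * m) := by
    refine Complex.norm_le_of_forall_mem_frontier_norm_le (U := Metric.ball 0 ρ)
      (f := fun z : ℂ => ((z ^ 2 + (ρ : ℂ) ^ 2) ^ m) • h z) Metric.isBounded_ball ?_ ?_ ?_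
    · have : Differentiable ℂ fun z : ℂ => ((z ^ 2 + (ρ : ℂ) ^ 2) ^ m) • h z := by fun_prop
      exact this.diffContOnCl
    · intro z hz
      rw [frontier_ball _ hρ0.ne', mem_sphere_zero_iff_norm] at hz
      have h1 : z ^ 2 + (ρ : ℂ) ^ 2 = z * (2 * z.re : ℝ) := by
        have h2 : (ρ : ℂ) ^ 2 = z * (starRingEnd ℂ) z := by
          rw [Complex.mul_conj, Complex.normSq_eq_norm_sq, hz]; push_cast; rfl
        rw [h2, ← Complex.add_conj]; ring
      have h3 : ‖z ^ 2 + (ρ : ℂ) ^ 2‖ = (2 * ρ) * |z.re| := by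
        rw [h1, norm_mul, hz, Complex.norm_real, Real.norm_eq_abs, abs_mul]
        simp; ring
      rw [norm_smul, norm_pow, h3, mul_pow]
      calc (2 * ρ) ^ m * |z.re| ^ m * ‖h z‖ = (2 * ρ) ^ m * (‖h z‖ * |z.re| ^ m) := by ring
        _ ≤ (2 * ρ) ^ m * (C * (1 + ‖z‖) ^ (2 * m)) := 
          mul_le_mul_of_nonneg_left (hb z) (by positivity)
        _ = _ := by rw [hz]; ring
    · apply subset_closure
      rw [mem_ball_zero_iff]; linarith
  have hlow : 3 * ‖s‖ ^ 2 ≤ ‖s ^ 2 + (ρ : ℂ) ^ 2‖ := by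
    have h1 : ‖(ρ : ℂ) ^ 2‖ ≤ ‖s ^ 2 + (ρ : ℂ) ^ 2‖ + ‖s ^ 2‖ := by
      have := norm_sub_le (s ^ 2 + (ρ : ℂ) ^ 2) (s ^ 2)
      rwa [add_sub_cancel_left] at this
    rw [norm_pow, norm_pow, Complex.norm_real, Real.norm_of_nonneg hρ0.le] at h1
    rw [hρ] at h1 ⊢
    nlinarith
  rw [norm_smul, norm_pow] at key
  have hpos : 0 < (3 * ‖s‖ ^ 2) ^ m := by positivity
  refine le_of_mul_le_mul_left ?_ hpos
  calc (3 * ‖s‖ ^ 2) ^ m * ‖h s‖ ≤ ‖s ^ 2 + (ρ : ℂ) ^ 2‖ ^ m * ‖h s‖ := by gcongr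
    _ ≤ C * (2 * ρ) ^ m * (1 + ρ) ^ (2 * m) := key
    _ ≤ C * (2 * ρ) ^ m * (3 * ‖s‖) ^ (2 * m) := by gcongr; linarith
    _ = (3 * ‖s‖ ^ 2) ^ m * (C * (12 * ‖s‖) ^ m) := by
      rw [hρ, pow_mul (3 * ‖s‖), mul_assoc, ← mul_pow,
        mul_left_comm ((3 * ‖s‖ ^ 2) ^ m) C, ← mul_pow]
      congr 2; ring_nf

theorem summable_pow_smul_and_norm_tsum_le {E : Type*} [NormedAddCommGroup E] [NormedSpace ℂ E]
    [CompleteSpace E] {X : ℕ → E} {C : ℝ} (hC : 0 ≤ C) {r : ℕ}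
    (hX : ∀ n : ℕ, ‖X n‖ ≤ C * ((n : ℝ) + 1) ^ r) {t : ℂ} (ht : ‖t‖ < 1) :
    Summable (fun n : ℕ => t ^ n • X n) ∧
      ‖∑' n : ℕ, t ^ n • X n‖ ≤ C * r.factorial / (1 - ‖t‖) ^ (r + 1) := by
  have hsum := (hasSum_choose_mul_geometric_of_norm_lt_one (𝕜 := ℝ) r
    (r := ‖t‖) (by simpa using ht)).mul_left (C * r.factorial)
  have hle : ∀ n : ℕ, ‖t ^ n • X n‖ ≤ C * r.factorial * (((n + r).choose r : ℕ) * ‖t‖ ^ n) := by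
    intro n
    have h1 : ((n : ℝ) + 1) ^ r ≤ r.factorial * ((n + r).choose r : ℕ) := by
      have := Nat.pow_succ_le_ascFactorial (n + 1) r
      rw [Nat.ascFactorial_eq_factorial_mul_choose] at this
      exact_mod_cast this
    rw [norm_smul, norm_pow]
    calc ‖t‖ ^ n * ‖X n‖ ≤ ‖t‖ ^ n * (C * (r.factorial * ((n + r).choose r : ℕ))) := by
          gcongr; exact (hX n).trans (by gcongr)
      _ = _ := by ring
  refine ⟨Summable.of_norm_bounded hsum.summable hle, ?_⟩
  have := tsum_of_norm_bounded hsum hle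
  simpa [mul_div_assoc, div_eq_mul_inv] using this

/-! ### Quasinilpotent elements and the growth of `a ^ n + a⁻¹ ^ n` -/


theorem exists_sq_sub_one_div_four (z : ℂ) : ∃ s : ℂ, (s ^ 2 - 1) / 4 = z := by
  obtain ⟨s, hs⟩ := IsAlgClosed.exists_pow_nat_eq (4 * z + 1) (n := 2) (by norm_num)
  exact ⟨s, by rw [hs]; ring⟩

/-- If `z = (s ^ 2 - 1) / 4`, then `1 - z • (N ^ 2 * V)` is the product of
`1 - ((s - 1) / 2) • N`, `1 + ((s + 1) / 2) • N` and `V`. -/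
theorem isUnit_one_sub_smul_mul_mul {𝔸 : Type*} [Ring 𝔸] [Algebra ℂ 𝔸] {N V : 𝔸}
    (hN : ∀ c : ℂ, IsUnit (1 - c • N))
    (hV : (1 + N) * V = 1) (hV' : V * (1 + N) = 1) (z : ℂ) :
    IsUnit (1 - z • (N * N * V)) := by
  obtain ⟨s, rfl⟩ := exists_sq_sub_one_div_four z
  have hu : IsUnit V := ⟨⟨V, 1 + N, hV', hV⟩, rfl⟩
  have h1 := ((hN ((s - 1) / 2)).mul (hN (-((s + 1) / 2)))).mul hu
  convert h1 using 1
  have h2 : V + N * V = 1 := by rw [← hV]; noncomm_ring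
  have h3 : (1 - ((s - 1) / 2) • N) * (1 - (-((s + 1) / 2)) • N) * V
      = V + N * V - ((s ^ 2 - 1) / 4) • (N * N * V) := by
    simp only [sub_mul, mul_sub, one_mul, mul_one, smul_mul_assoc, mul_smul_comm]
    module
  rw [h3, h2]

/-- The generating function of `Xₙ = (1 + N) ^ n + V ^ n`, with `V = (1 + N)⁻¹`, evaluated at the
Cayley transform `t` of `s`: it is an affine function of the resolvent of `N ^ 2 * V`. -/
theorem one_sub_smul_mul_tsum_sub_one {𝔸 : Type*} [NormedRing 𝔸] [NormedAlgebra ℂ 𝔸]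
    {N V : 𝔸} (hV : (1 + N) * V = 1) (hV' : V * (1 + N) = 1) {s t : ℂ} (hs : s + 1 ≠ 0)
    (ht : t = (s - 1) / (s + 1))
    (hsum : Summable fun n : ℕ => t ^ n • ((1 + N) ^ n + V ^ n)) :
    (1 - ((s ^ 2 - 1) / 4) • (N * N * V)) * ((∑' n : ℕ, t ^ n • ((1 + N) ^ n + V ^ n)) - 1)
      = s • (1 : 𝔸) := by
  set X : ℕ → 𝔸 := fun n => (1 + N) ^ n + V ^ n with hX
  set Y : 𝔸 := ∑' n : ℕ, t ^ n • X n with hY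
  set S : 𝔸 := N * N * V with hS
  have hP : S + 2 = (1 + N) + V := by
    have h1 : S = N * ((1 + N) * V) - (1 + N) * V + V := by rw [hS]; noncomm_ring
    rw [h1, hV, ← one_add_one_eq_two]; noncomm_ring
  have hrec : ∀ n, X (n + 2) = (S + 2) * X (n + 1) - X n := by
    intro n
    have h1 : V * (1 + N) ^ (n + 1) = (1 + N) ^ n := by
      rw [pow_succ', ← mul_assoc, hV', one_mul]
    have h2 : (1 + N) * V ^ (n + 1) = V ^ n := by
      rw [pow_succ', ← mul_assoc, hV, one_mul]
    simp only [hX, hP, add_mul _ V, mul_add _ ((1 + N) ^ (n + 1)), h1, h2,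
      pow_succ' _ (n + 1)]
    abel
  have hY1 : Y = (2 : ℂ) • (1 : 𝔸) + ∑' n : ℕ, t ^ (n + 1) • X (n + 1) := by
    rw [hY, hsum.tsum_eq_zero_add]; simp [hX, two_smul]
  have hs1 : Summable fun n : ℕ => t ^ (n + 1) • X (n + 1) := 
    (summable_nat_add_iff (f := fun n : ℕ => t ^ n • X n) 1).2 hsum
  have hY2 : Y = (2 : ℂ) • (1 : 𝔸) + t • (S + 2) + ∑' n : ℕ, t ^ (n + 2) • X (n + 2) := by
    rw [hY1, hs1.tsum_eq_zero_add, hP]; simp [hX, add_assoc]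
  have hY3 : ∑' n : ℕ, t ^ (n + 2) • X (n + 2)
      = t • ((S + 2) * (Y - (2 : ℂ) • (1 : 𝔸))) - t ^ 2 • Y := by
    have h1 : Y - (2 : ℂ) • (1 : 𝔸) = ∑' n : ℕ, t ^ (n + 1) • X (n + 1) := by
      rw [hY1]; abel
    rw [h1, hY, ← hs1.tsum_mul_left, ← (hs1.mul_left _).tsum_const_smul,
      ← hsum.tsum_const_smul, ← ((hs1.mul_left _).const_smul _).tsum_sub (hsum.const_smul _)]
    refine tsum_congr fun n => ?_
    rw [hrec, mul_smul_comm, smul_smul, smul_smul, smul_sub]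
    congr 2 <;> ring
  have h2 : (2 : 𝔸) = (2 : ℂ) • (1 : 𝔸) := by rw [two_smul]; norm_num
  rw [hY3, h2] at hY2
  simp only [add_mul, sub_mul, mul_sub, one_mul, mul_one, smul_mul_assoc, mul_smul_comm] at hY2 ⊢
  subst ht
  linear_combination (norm := skip) ((s + 1) ^ 2 / 4) • hY2
  match_scalars <;> field_simp <;> ring

/-- If `1 + N` has an inverse `V`, if `N` is quasinilpotent and if `(1 + N) ^ n + V ^ n` has
polynomial growth, then `N` is nilpotent. -/
theorem isNilpotent_of_norm_pow_add_pow_le {𝔸 : Type*} [NormedRing 𝔸] [NormedAlgebra ℂ 𝔸]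
    [CompleteSpace 𝔸] {N V : 𝔸} (hN : ∀ c : ℂ, IsUnit (1 - c • N))
    (hV : (1 + N) * V = 1) (hV' : V * (1 + N) = 1) {C : ℝ} {r : ℕ}
    (hX : ∀ n : ℕ, ‖(1 + N) ^ n + V ^ n‖ ≤ C * ((n : ℝ) + 1) ^ r) : IsNilpotent N := by
  have hC : 0 ≤ C := by simpa using (norm_nonneg _).trans (hX 0)
  set S : 𝔸 := N * N * V with hS
  set G : ℂ → 𝔸 := fun s => Ring.inverse (1 - ((s ^ 2 - 1) / 4) • S) with hG
  have hu : ∀ s : ℂ, IsUnit (1 - ((s ^ 2 - 1) / 4) • S) := fun s =>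
    isUnit_one_sub_smul_mul_mul hN hV hV' _
  have hGd : Differentiable ℂ G := by
    intro s
    have h1 : DifferentiableAt ℂ (fun s : ℂ => 1 - ((s ^ 2 - 1) / 4) • S) s := by fun_prop
    have h2 := differentiableAt_inverse (𝕜 := ℂ) (hu s)
    exact h2.comp s h1
  have hGeq : ∀ s, (1 - ((s ^ 2 - 1) / 4) • S) * G s = 1 := fun s =>
    Ring.mul_inverse_cancel _ (hu s)
  have hGeq' : ∀ s, G s * (1 - ((s ^ 2 - 1) / 4) • S) = 1 := fun s =>
    Ring.inverse_mul_cancel _ (hu s)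
  set m := r + 1 with hm
  set D : ℝ := ‖(1 : 𝔸)‖ + C * r.factorial with hD
  have hD0 : 0 ≤ D := by positivity
  -- The estimate in the right half-plane, where the Cayley transform lies in the unit disc.
  have hright : ∀ s : ℂ, 0 < s.re → ‖s • G s‖ * s.re ^ m ≤ D * (1 + ‖s‖) ^ (2 * m) := by
    intro s hs
    have hs1 : s + 1 ≠ 0 := by
      intro h; have := congrArg Complex.re h; simp at this; linarith
    have hs1' : 0 < ‖s + 1‖ := norm_pos_iff.2 hs1
    set t : ℂ := (s - 1) / (s + 1) with ht
    have hsq : ‖s + 1‖ ^ 2 - ‖s - 1‖ ^ 2 = 4 * s.re := by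
      rw [← Complex.normSq_eq_norm_sq, ← Complex.normSq_eq_norm_sq, Complex.normSq_apply,
        Complex.normSq_apply]
      simp; ring
    have hlt : ‖s - 1‖ < ‖s + 1‖ := by
      refine lt_of_pow_lt_pow_left₀ 2 hs1'.le ?_; linarith
    have htn : ‖t‖ = ‖s - 1‖ / ‖s + 1‖ := norm_div _ _
    have ht1 : ‖t‖ < 1 := by rw [htn, div_lt_one hs1']; exact hlt
    obtain ⟨hsum, hbd⟩ := summable_pow_smul_and_norm_tsum_le hC hX ht1
    have hid := one_sub_smul_mul_tsum_sub_one hV hV' hs1 ht hsum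
    set Y := ∑' n : ℕ, t ^ n • ((1 + N) ^ n + V ^ n) with hY
    have hsG : s • G s = Y - 1 := by
      have := congrArg (fun y => G s * y) hid
      simp only [← mul_assoc, ← hS, hGeq', one_mul, mul_smul_comm, mul_one] at this
      exact this.symm
    have htri : ‖s + 1‖ ≤ 1 + ‖s‖ := by
      have := norm_add_le s 1; simp at this; linarith
    have h1 : s.re ≤ (1 - ‖t‖) * (1 + ‖s‖) ^ 2 := by
      have h2 : (1 - ‖t‖) * ‖s + 1‖ = ‖s + 1‖ - ‖s - 1‖ := by rw [htn]; field_simp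
      have h3 : 2 * s.re ≤ (1 - ‖t‖) * ‖s + 1‖ ^ 2 := by
        have : (1 - ‖t‖) * ‖s + 1‖ ^ 2 = (‖s + 1‖ - ‖s - 1‖) * ‖s + 1‖ := by rw [← h2]; ring
        rw [this]; nlinarith [norm_nonneg (s - 1)]
      have h4 : (1 - ‖t‖) * ‖s + 1‖ ^ 2 ≤ (1 - ‖t‖) * (1 + ‖s‖) ^ 2 := by
        have : 0 ≤ 1 - ‖t‖ := by linarith
        gcongr
      linarith
    have h5 : s.re ^ m ≤ (1 - ‖t‖) ^ m * (1 + ‖s‖) ^ (2 * m) := by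
      rw [pow_mul, ← mul_pow]; gcongr
    have h6 : s.re ^ m ≤ (1 + ‖s‖) ^ (2 * m) := by
      refine h5.trans (mul_le_of_le_one_left (by positivity) ?_)
      exact pow_le_one₀ (by linarith) (by linarith [norm_nonneg t])
    have h7 : 0 < (1 - ‖t‖) ^ m := pow_pos (by linarith) _
    rw [hsG]
    calc ‖Y - 1‖ * s.re ^ m ≤ (‖Y‖ + ‖(1 : 𝔸)‖) * s.re ^ m := by
          gcongr; exact norm_sub_le _ _
      _ = ‖Y‖ * s.re ^ m + ‖(1 : 𝔸)‖ * s.re ^ m := add_mul _ _ _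
      _ ≤ (C * r.factorial / (1 - ‖t‖) ^ m) * ((1 - ‖t‖) ^ m * (1 + ‖s‖) ^ (2 * m))
          + ‖(1 : 𝔸)‖ * (1 + ‖s‖) ^ (2 * m) := by gcongr
      _ = D * (1 + ‖s‖) ^ (2 * m) := by rw [hD]; field_simp; ring
  -- `G` is even, so the estimate also holds in the left half-plane.
  have hall : ∀ s : ℂ, ‖s • G s‖ * |s.re| ^ m ≤ D * (1 + ‖s‖) ^ (2 * m) := by
    intro s
    rcases lt_trichotomy s.re 0 with h | h | h
    · have := hright (-s) (by simpa using h)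
      have hGn : G (-s) = G s := by simp [hG]
      rw [hGn, neg_smul, norm_neg, norm_neg, Complex.neg_re] at this
      rwa [abs_of_neg h]
    · rw [h, abs_zero, zero_pow (by omega), mul_zero]; positivity
    · rw [abs_of_pos h]; exact hright s h
  have hpoly : ∀ s : ℂ, 1 ≤ ‖s‖ → ‖s • G s‖ ≤ D * (12 * ‖s‖) ^ m := fun s hs =>
    norm_le_of_norm_mul_abs_re_pow_le (h := fun s => s • G s) (by fun_prop) hD0 hall hs
  have hstep : ∀ (k : ℕ) (s : ℂ),
      S ^ k * G s = S ^ k + ((s ^ 2 - 1) / 4) • (S ^ (k + 1) * G s) := by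
    intro k s
    have := hGeq s
    rw [sub_mul, one_mul, smul_mul_assoc, sub_eq_iff_eq_add] at this
    nth_rw 1 [this]
    rw [mul_add, mul_one, mul_smul_comm, ← mul_assoc, ← pow_succ]
  -- Each factor `S` gains a factor `‖s‖⁻¹` (in fact `‖s‖⁻²`) at infinity.
  have hdecay : ∀ k ≤ m, ∃ M : ℝ, ∀ s : ℂ, 6 ≤ ‖s‖ → ‖S ^ k * G s‖ * ‖s‖ ^ k ≤ M * ‖s‖ ^ m := by
    intro k
    induction k with
    | zero =>
      intro _
      refine ⟨D * 12 ^ m, fun s hs => ?_⟩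
      have h1 := hpoly s (by linarith)
      rw [norm_smul] at h1
      rw [pow_zero, one_mul, pow_zero, mul_one]
      calc ‖G s‖ ≤ ‖s‖ * ‖G s‖ := le_mul_of_one_le_left (norm_nonneg _) (by linarith)
        _ ≤ _ := by rw [mul_assoc, ← mul_pow]; exact h1
    | succ k ih =>
      intro hk
      obtain ⟨M, hM⟩ := ih (by omega)
      refine ⟨M + ‖S ^ k‖, fun s hs => ?_⟩
      have h1 : ‖s‖ ≤ ‖(s ^ 2 - 1) / 4‖ := by
        have h2 : ‖s ^ 2‖ ≤ ‖s ^ 2 - 1‖ + ‖(1 : ℂ)‖ := by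
          have := norm_add_le (s ^ 2 - 1) 1
          rwa [sub_add_cancel] at this
        rw [norm_pow, norm_one] at h2
        rw [norm_div]
        have : ‖(4 : ℂ)‖ = 4 := by norm_num
        rw [this, le_div_iff₀ (by norm_num)]
        nlinarith
      have h3 : ‖s‖ * ‖S ^ (k + 1) * G s‖ ≤ ‖S ^ k * G s‖ + ‖S ^ k‖ := by
        calc ‖s‖ * ‖S ^ (k + 1) * G s‖ ≤ ‖((s ^ 2 - 1) / 4) • (S ^ (k + 1) * G s)‖ := by
              rw [norm_smul]; gcongr
          _ = ‖S ^ k * G s - S ^ k‖ := by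
              congr 1; rw [eq_sub_iff_add_eq, add_comm]; exact (hstep k s).symm
          _ ≤ _ := norm_sub_le _ _
      calc ‖S ^ (k + 1) * G s‖ * ‖s‖ ^ (k + 1)
          = (‖s‖ * ‖S ^ (k + 1) * G s‖) * ‖s‖ ^ k := by ring
        _ ≤ (‖S ^ k * G s‖ + ‖S ^ k‖) * ‖s‖ ^ k := by gcongr
        _ = ‖S ^ k * G s‖ * ‖s‖ ^ k + ‖S ^ k‖ * ‖s‖ ^ k := add_mul _ _ _
        _ ≤ M * ‖s‖ ^ m + ‖S ^ k‖ * ‖s‖ ^ m := by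
            refine add_le_add (hM s hs) (mul_le_mul_of_nonneg_left ?_ (norm_nonneg _))
            exact pow_le_pow_right₀ (by linarith) (by omega)
        _ = _ := by ring
  obtain ⟨M, hM⟩ := hdecay m le_rfl
  have hFd : Differentiable ℂ fun s => S ^ m * G s := by fun_prop
  have hbdd : Bornology.IsBounded (Set.range fun s => S ^ m * G s) := by
    obtain ⟨M', hM'⟩ := (isCompact_closedBall (0 : ℂ) 6).exists_bound_of_continuousOn
      hFd.continuous.continuousOn
    refine isBounded_iff_forall_norm_le.2 ⟨max M M', ?_⟩
    rintro _ ⟨s, rfl⟩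
    rcases le_total ‖s‖ 6 with h | h
    · exact (hM' s (by simpa using h)).trans (le_max_right _ _)
    · refine le_trans ?_ (le_max_left _ _)
      have : 0 < ‖s‖ ^ m := by positivity
      exact le_of_mul_le_mul_right (hM s h) this
  have hnil : S ^ (m + 1) = 0 := by
    have h1 := hFd.apply_eq_apply_of_bounded hbdd 3 1
    have hG1 : G 1 = 1 := by simp [hG]
    have h2 := hstep m 3
    simp only [hG1, mul_one] at h1
    rw [h1, left_eq_add, smul_eq_zero] at h2
    have h3 : S ^ (m + 1) * G 3 = 0 := h2.resolve_left (by norm_num)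
    have := congrArg (fun y => y * (1 - (((3 : ℂ) ^ 2 - 1) / 4) • S)) h3
    simpa only [mul_assoc, hGeq', mul_one, zero_mul] using this
  have hcomm : Commute S (1 + N) := by
    have h1 : Commute N (1 + N) := (Commute.one_right N).add_right (Commute.refl N)
    have h2 : Commute V (1 + N) := by rw [Commute, SemiconjBy, hV, hV']
    exact (h1.mul_left h1).mul_left h2
  have hsq : N ^ 2 = S * (1 + N) := by rw [hS, mul_assoc, hV', mul_one, sq]
  refine ⟨2 * (m + 1), ?_⟩
  rw [pow_mul, hsq, hcomm.mul_pow, hnil, zero_mul]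

/-- Polynomial growth of `(1 + N) ^ n + lam • V ^ n`, for any `lam ≠ 0`, passes to
`(1 + N) ^ (2 * n) + V ^ (2 * n)`. -/
theorem norm_pow_add_pow_le_of_norm_pow_add_smul_pow_le {𝔸 : Type*} [NormedRing 𝔸]
    [NormedAlgebra ℂ 𝔸] {A V : 𝔸} (hV : A * V = 1) (hV' : V * A = 1) {lam : ℂ} (hlam : lam ≠ 0)
    {C : ℝ} {r : ℕ} (hX : ∀ n : ℕ, ‖A ^ n + lam • V ^ n‖ ≤ C * ((n : ℝ) + 1) ^ r) (n : ℕ) :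
    ‖(A ^ 2) ^ n + (V ^ 2) ^ n‖
      ≤ (C * 2 ^ r + ‖lam⁻¹‖ * (C ^ 2 + C * 2 ^ r) + ‖(2 : 𝔸)‖) * ((n : ℝ) + 1) ^ (2 * r) := by
  have hC : 0 ≤ C := by simpa using (norm_nonneg _).trans (hX 0)
  have hc : Commute A V := by rw [Commute, SemiconjBy, hV, hV']
  have h1 : A ^ n * V ^ n = 1 := by rw [← hc.mul_pow, hV, one_pow]
  have h2 : V ^ n * A ^ n = 1 := by rw [← hc.symm.mul_pow, hV', one_pow]
  -- Squaring `A ^ n + lam • V ^ n` changes the coefficient of `V ^ (2 * n)` into `lam ^ 2`.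
  have key : (A ^ 2) ^ n + (V ^ 2) ^ n = (A ^ (2 * n) + lam • V ^ (2 * n))
      - lam⁻¹ • ((A ^ n + lam • V ^ n) ^ 2 - (A ^ (2 * n) + lam • V ^ (2 * n))) + 2 := by
    have h3 : (A ^ n + lam • V ^ n) ^ 2
        = A ^ (2 * n) + (lam ^ 2) • V ^ (2 * n) + (2 * lam) • (1 : 𝔸) := by
      rw [sq, add_mul, mul_add, mul_add, mul_smul_comm, smul_mul_assoc, smul_mul_smul_comm, h1, h2,
        ← pow_add, ← pow_add, ← two_mul]
      module
    have h4 : (2 : 𝔸) = (2 : ℂ) • (1 : 𝔸) := by rw [two_smul]; norm_num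
    rw [h3, h4, ← pow_mul, ← pow_mul]
    match_scalars <;> field_simp <;> ring
  set x : ℝ := (n : ℝ) + 1 with hx
  have hx1 : 1 ≤ x := by rw [hx]; linarith [(Nat.cast_nonneg n : (0 : ℝ) ≤ n)]
  have hxr : (1 : ℝ) ≤ x ^ (2 * r) := one_le_pow₀ hx1
  have h5 : ‖A ^ (2 * n) + lam • V ^ (2 * n)‖ ≤ C * 2 ^ r * x ^ (2 * r) := by
    refine (hX (2 * n)).trans ?_
    rw [mul_assoc]
    gcongr
    calc (((2 * n : ℕ) : ℝ) + 1) ^ r ≤ (2 * x) ^ r := by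
          gcongr; rw [hx]; push_cast; linarith
      _ = 2 ^ r * x ^ r := mul_pow _ _ _
      _ ≤ 2 ^ r * x ^ (2 * r) := by
          gcongr
          omega
  have h6 : ‖(A ^ n + lam • V ^ n) ^ 2‖ ≤ C ^ 2 * x ^ (2 * r) := by
    rw [sq]
    refine (norm_mul_le _ _).trans ?_
    calc _ ≤ (C * x ^ r) * (C * x ^ r) := by gcongr <;> exact hX n
      _ = _ := by ring
  rw [key]
  calc _ ≤ ‖A ^ (2 * n) + lam • V ^ (2 * n)‖ + ‖lam⁻¹‖ * (‖(A ^ n + lam • V ^ n) ^ 2‖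
        + ‖A ^ (2 * n) + lam • V ^ (2 * n)‖) + ‖(2 : 𝔸)‖ * 1 := by
        rw [mul_one]
        refine (norm_add_le _ _).trans (add_le_add_left ((norm_sub_le _ _).trans ?_) _)
        refine add_le_add_right ?_ _
        rw [norm_smul]
        gcongr
        exact norm_sub_le _ _
    _ ≤ C * 2 ^ r * x ^ (2 * r) + ‖lam⁻¹‖ * (C ^ 2 * x ^ (2 * r) + C * 2 ^ r * x ^ (2 * r))
        + ‖(2 : 𝔸)‖ * x ^ (2 * r) := by gcongr
    _ = _ := by ring

theorem isNilpotent_of_norm_pow_add_smul_pow_le {𝔸 : Type*} [NormedRing 𝔸] [NormedAlgebra ℂ 𝔸]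
    [CompleteSpace 𝔸] {N V : 𝔸} (hN : ∀ c : ℂ, IsUnit (1 - c • N))
    (hV : (1 + N) * V = 1) (hV' : V * (1 + N) = 1) {lam : ℂ} (hlam : lam ≠ 0) {C : ℝ} {r : ℕ}
    (hX : ∀ n : ℕ, ‖(1 + N) ^ n + lam • V ^ n‖ ≤ C * ((n : ℝ) + 1) ^ r) : IsNilpotent N := by
  have hsq : (1 + N) ^ 2 = 1 + N * (2 + N) := by rw [← one_add_one_eq_two]; noncomm_ring
  have hX2 := norm_pow_add_pow_le_of_norm_pow_add_smul_pow_le hV hV' hlam hX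
  rw [hsq] at hX2
  have hN2 : ∀ c : ℂ, IsUnit (1 - c • (N * (2 + N))) := by
    intro c
    -- Factor `1 - c * x * (2 + x)` as `(1 - (c + w) * x) * (1 - (c - w) * x)`.
    obtain ⟨w, hw⟩ := IsAlgClosed.exists_pow_nat_eq (c ^ 2 + c) (n := 2) (by norm_num)
    convert (hN (c + w)).mul (hN (c - w)) using 1
    have h2 : (2 : 𝔸) = (2 : ℂ) • (1 : 𝔸) := by rw [two_smul]; norm_num
    simp only [h2, sub_mul, mul_sub, mul_add, one_mul, mul_one, smul_mul_assoc, mul_smul_comm]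
    match_scalars
    · ring
    · ring
    · linear_combination hw
  have hnil : IsNilpotent (N * (2 + N)) := by
    refine isNilpotent_of_norm_pow_add_pow_le (V := V ^ 2) hN2 ?_ ?_ hX2
    · rw [← hsq, sq, sq, mul_assoc, ← mul_assoc _ V V, hV, one_mul, hV]
    · rw [← hsq, sq, sq, mul_assoc, ← mul_assoc V (1 + N), hV', one_mul, hV']
  have hu : IsUnit (2 + N) := by
    have h1 := (hN (-(1 / 2))).smul (Units.mk0 (2 : ℂ) two_ne_zero)
    convert h1 using 1
    have h2 : (2 : 𝔸) = (2 : ℂ) • (1 : 𝔸) := by rw [two_smul]; norm_num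
    rw [Units.smul_mk0, h2, smul_sub, smul_smul]
    module
  have hc : Commute N (2 + N) := by
    rw [← one_add_one_eq_two]
    exact ((Commute.one_right N).add_right (Commute.one_right N)).add_right (Commute.refl N)
  obtain ⟨k, hk⟩ := hnil
  rw [hc.mul_pow] at hk
  exact ⟨k, (hu.pow k).mul_left_eq_zero.1 hk⟩

/-! ### The index of nilpotency -/

theorem mul_one_add_pow_eq_sum {R : Type*} [Ring R] {Q M : R} {j : ℕ} (h : Q * M ^ (j + 1) = 0)
    (n : ℕ) : Q * (1 + M) ^ n = ∑ k ∈ Finset.range (j + 1), n.choose k • (Q * M ^ k) := by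
  have h1 : Q * (1 + M) ^ n = ∑ k ∈ Finset.range (n + 1), n.choose k • (Q * M ^ k) := by
    rw [add_comm, (Commute.one_right M).add_pow, Finset.mul_sum]
    refine Finset.sum_congr rfl fun k _ => ?_
    rw [one_pow, mul_one, nsmul_eq_mul, ← mul_assoc, Nat.cast_comm]
  rw [h1]
  trans ∑ k ∈ Finset.range (n + 1 + (j + 1)), n.choose k • (Q * M ^ k)
  · refine Finset.sum_subset (Finset.range_mono (by omega)) fun k _ hk => ?_
    rw [Finset.mem_range, not_lt] at hk
    rw [Nat.choose_eq_zero_of_lt (by omega), zero_smul]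
  · refine (Finset.sum_subset (Finset.range_mono (by omega)) fun k _ hk => ?_).symm
    rw [Finset.mem_range, not_lt] at hk
    obtain ⟨i, rfl⟩ := Nat.exists_eq_add_of_le hk
    rw [pow_add, ← mul_assoc, h, zero_mul, smul_zero]

theorem eq_zero_of_sum_choose_smul_isLittleO {E : Type*} [NormedAddCommGroup E] [NormedSpace ℂ E]
    {j : ℕ} {c : ℕ → E}
    (h : (fun n : ℕ => ∑ k ∈ Finset.range (j + 1), n.choose k • c k)
      =o[atTop] fun n : ℕ => (n : ℝ) ^ j) : c j = 0 := by
  have hlow : (fun n : ℕ => ∑ k ∈ Finset.range j, n.choose k • c k)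
      =o[atTop] fun n : ℕ => (n : ℝ) ^ j := by
    refine IsLittleO.fun_sum fun k hk => ?_
    rw [Finset.mem_range] at hk
    have h1 : (fun n : ℕ => n.choose k • c k) =O[atTop] fun n : ℕ => (n : ℝ) ^ k := by
      refine IsBigO.trans (g := fun n : ℕ => (n.choose k : ℝ)) ?_ (isTheta_choose k).1
      refine IsBigO.of_bound ‖c k‖ (Eventually.of_forall fun n => ?_)
      rw [mul_comm, Real.norm_natCast]
      rw [← Nat.cast_smul_eq_nsmul ℂ, norm_smul, Complex.norm_natCast]
    exact h1.trans_isLittleO ((isLittleO_pow_pow_atTop_of_lt hk).comp_tendsto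
      tendsto_natCast_atTop_atTop)
  have htop : (fun n : ℕ => n.choose j • c j) =o[atTop] fun n : ℕ => (n.choose j : ℝ) := by
    refine IsLittleO.trans_isTheta ?_ (isTheta_choose j).symm
    refine (h.sub hlow).congr_left fun n => ?_
    rw [Finset.sum_range_succ, add_sub_cancel_left]
  by_contra hc
  have hpos : 0 < ‖c j‖ := norm_pos_iff.2 hc
  obtain ⟨n, hn, hjn⟩ := ((htop.def (half_pos hpos)).and (eventually_ge_atTop j)).exists
  have hch : (0 : ℝ) < n.choose j := by exact_mod_cast Nat.choose_pos hjn
  rw [← Nat.cast_smul_eq_nsmul ℂ, norm_smul, Complex.norm_natCast, Real.norm_natCast] at hn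
  nlinarith [mul_pos hch hpos]

/-- The coefficient of `n ^ j` in `N ^ (d - j) * ((1 + N) ^ n + lam • V ^ n)`, a polynomial in `n`
of degree at most `j`, is `(1 + lam * (-1) ^ j) / j !` times `N ^ d`. -/
theorem pow_eq_zero_of_isBigO {𝔸 : Type*} [NormedRing 𝔸] [NormedAlgebra ℂ 𝔸] {N V : 𝔸}
    (hV : (1 + N) * V = 1) (hV' : V * (1 + N) = 1) {lam : ℂ} {r j d : ℕ}
    (hX : (fun n : ℕ => ‖(1 + N) ^ n + lam • V ^ n‖) =O[atTop] fun n : ℕ => (n : ℝ) ^ r)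
    (hd : N ^ (d + 1) = 0) (hjd : j ≤ d) (hrj : r < j) (hl : 1 + lam * (-1) ^ j ≠ 0) :
    N ^ d = 0 := by
  obtain ⟨e, rfl⟩ := Nat.exists_eq_add_of_le' hjd
  have hNV : Commute N V := by
    have h1 : N * V = 1 - V := by rw [← hV]; noncomm_ring
    have h2 : V * N = 1 - V := by rw [← hV']; noncomm_ring
    rw [Commute, SemiconjBy, h1, h2]
  set M : 𝔸 := -(N * V) with hM
  have hVM : V = 1 + M := by rw [hM, ← hV]; noncomm_ring
  have hMk : ∀ k, N ^ e * M ^ k = (-1 : ℂ) ^ k • (N ^ (e + k) * V ^ k) := by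
    intro k
    have : M = (-1 : ℂ) • (N * V) := by rw [hM, neg_one_smul]
    rw [this, _root_.smul_pow, hNV.mul_pow, mul_smul_comm, ← mul_assoc, pow_add]
  have hsum : ∀ n : ℕ, N ^ e * ((1 + N) ^ n + lam • V ^ n)
      = ∑ k ∈ Finset.range (j + 1), n.choose k • (N ^ e * N ^ k + lam • (N ^ e * M ^ k)) := by
    intro n
    rw [mul_add, mul_smul_comm, mul_one_add_pow_eq_sum (j := j) (by rw [← pow_add]; exact hd)]
    nth_rw 1 [hVM]
    rw [mul_one_add_pow_eq_sum (j := j) (by rw [hMk, ← add_assoc, hd, zero_mul, smul_zero]),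
      Finset.smul_sum, ← Finset.sum_add_distrib]
    refine Finset.sum_congr rfl fun k _ => ?_
    rw [smul_add, smul_comm]
  have hlit : (fun n : ℕ => ∑ k ∈ Finset.range (j + 1),
      n.choose k • (N ^ e * N ^ k + lam • (N ^ e * M ^ k))) =o[atTop] fun n : ℕ => (n : ℝ) ^ j := by
    simp only [← hsum]
    have h1 : (fun n : ℕ => N ^ e * ((1 + N) ^ n + lam • V ^ n))
        =O[atTop] fun n : ℕ => (n : ℝ) ^ r := by
      refine IsBigO.trans (IsBigO.of_bound ‖N ^ e‖ (Eventually.of_forall fun n => ?_)) hX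
      rw [norm_norm]
      exact norm_mul_le _ _
    exact h1.trans_isLittleO ((isLittleO_pow_pow_atTop_of_lt hrj).comp_tendsto
      tendsto_natCast_atTop_atTop)
  have h0 := eq_zero_of_sum_choose_smul_isLittleO hlit
  have hVk : ∀ k, N ^ (e + j) * V ^ k = N ^ (e + j) := by
    intro k
    induction k with
    | zero => simp
    | succ k ih =>
      rw [pow_succ, ← mul_assoc, ih, hVM, mul_add, mul_one, hM, mul_neg, ← mul_assoc, ← pow_succ,
        hd, zero_mul, neg_zero, add_zero]
  rw [hMk, hVk, ← pow_add, smul_smul, ← one_smul ℂ (N ^ (e + j)), smul_smul, mul_one,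
    ← add_smul] at h0
  exact (smul_eq_zero.1 h0).resolve_left hl

theorem pow_add_two_eq_zero_of_isBigO {𝔸 : Type*} [NormedRing 𝔸] [NormedAlgebra ℂ 𝔸]
    [CompleteSpace 𝔸] {N V : 𝔸} (hN : ∀ c : ℂ, IsUnit (1 - c • N))
    (hV : (1 + N) * V = 1) (hV' : V * (1 + N) = 1) {lam : ℂ} (hlam : lam ≠ 0) {r : ℕ}
    (hX : (fun n : ℕ => ‖(1 + N) ^ n + lam • V ^ n‖) =O[atTop] fun n : ℕ => (n : ℝ) ^ r) :
    N ^ (r + 2) = 0 := by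
  have hnil : IsNilpotent N := by
    have h1 : (fun n : ℕ => ‖(1 + N) ^ n + lam • V ^ n‖)
        =O[atTop] fun n : ℕ => ((n : ℝ) + 1) ^ r := by
      refine hX.trans (IsBigO.of_bound 1 (Eventually.of_forall fun n => ?_))
      rw [one_mul, Real.norm_of_nonneg (by positivity), Real.norm_of_nonneg (by positivity)]
      gcongr; linarith
    obtain ⟨C, _, hC⟩ := bound_of_isBigO_nat_atTop h1
    refine isNilpotent_of_norm_pow_add_smul_pow_le hN hV hV' hlam (C := C) (r := r) fun n => ?_
    have := hC (x := n) (by positivity)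
    rwa [norm_norm, Real.norm_of_nonneg (by positivity)] at this
  have hdown : ∀ d, r + 2 ≤ d → N ^ (d + 1) = 0 → N ^ d = 0 := by
    intro d hd h
    -- `1 + lam * (-1) ^ j` can vanish for at most one of `j = r + 1` and `j = r + 2`.
    by_cases hl : 1 + lam * (-1) ^ (r + 1) = 0
    · refine pow_eq_zero_of_isBigO hV hV' hX h hd (by omega) fun hl' => ?_
      rw [pow_succ _ (r + 1)] at hl'
      have : (2 : ℂ) = 0 := by linear_combination hl + hl'
      exact two_ne_zero this
    · exact pow_eq_zero_of_isBigO hV hV' hX h (j := r + 1) (by omega) (by omega) hl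
  obtain ⟨k, hk⟩ := hnil
  have hall : ∀ i, N ^ (r + 2 + i) = 0 → N ^ (r + 2) = 0 := by
    intro i
    induction i with
    | zero => exact id
    | succ i ih => exact fun h => ih (hdown _ (by omega) h)
  exact hall k (by rw [pow_add, hk, mul_zero])

/-! ### Compact operators commuting with `T` -/

theorem isCompactOperator_add_pow_sub_pow {E : Type*} [NormedAddCommGroup E] [NormedSpace ℂ E]
    {K : E →L[ℂ] E} (hK : IsCompactOperator K) (T : E →L[ℂ] E) (m : ℕ) :
    IsCompactOperator ((T + K) ^ m - T ^ m : E →L[ℂ] E) := by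
  induction m with
  | zero => simpa using isCompactOperator_zero
  | succ m ih =>
    have h1 : (T + K) ^ (m + 1) - T ^ (m + 1)
        = T * ((T + K) ^ m - T ^ m) + K * (T + K) ^ m := by
      rw [pow_succ' (T + K), pow_succ' T, add_mul, mul_sub]; abel
    rw [h1]
    exact (ih.clm_comp T).add (hK.comp_clm ((T + K) ^ m))

theorem tendsto_pow_mul_norm_pow_of_spectralRadius_eq_zero {𝔸 : Type*} [NormedRing 𝔸]
    [NormedAlgebra ℂ 𝔸] [CompleteSpace 𝔸] {a : 𝔸} (ha : spectralRadius ℂ a = 0) {c : ℝ}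
    (hc : 0 < c) : Tendsto (fun n : ℕ => c ^ n * ‖a ^ n‖) atTop (nhds 0) := by
  have h1 := spectrum.pow_norm_pow_one_div_tendsto_nhds_spectralRadius a
  rw [ha] at h1
  have h2 := h1.eventually (gt_mem_nhds
    (ENNReal.ofReal_pos.2 (show 0 < (2 * c)⁻¹ by positivity)))
  refine squeeze_zero' (Eventually.of_forall fun n => by positivity) ?_
    (tendsto_pow_atTop_nhds_zero_of_lt_one (r := (1 / 2 : ℝ)) (by norm_num) (by norm_num))
  filter_upwards [h2, eventually_gt_atTop 0] with n hn hn0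
  have h3 : ‖a ^ n‖ ^ (1 / n : ℝ) < (2 * c)⁻¹ :=
    (ENNReal.ofReal_lt_ofReal_iff (by positivity)).1 hn
  have h4 : ‖a ^ n‖ ≤ ((2 * c)⁻¹) ^ n := by
    have h5 : (‖a ^ n‖ ^ (1 / n : ℝ)) ^ n = ‖a ^ n‖ := by
      rw [one_div]; exact Real.rpow_inv_natCast_pow (norm_nonneg _) hn0.ne'
    rw [← h5]
    exact pow_le_pow_left₀ (by positivity) h3.le n
  calc c ^ n * ‖a ^ n‖ ≤ c ^ n * ((2 * c)⁻¹) ^ n := by gcongr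
    _ = (1 / 2) ^ n := by rw [← mul_pow]; congr 1; field_simp

/-- The closure of the orbit `{p(T) y}` of a vector is an invariant subspace. -/
theorem IsIntransitive.of_not_dense_orbit {H : Type*} [NormedAddCommGroup H]
    [InnerProductSpace ℂ H] {T : H →L[ℂ] H} {y : H} (hy : y ≠ 0)
    (h : ¬ Dense (Set.range fun p : ℂ[X] => (aeval T p : H →L[ℂ] H) y)) : IsIntransitive T := by
  let L : ℂ[X] →ₗ[ℂ] H :=
    { toFun := fun p => (aeval T p : H →L[ℂ] H) y
      map_add' := fun p q => by simp
      map_smul' := fun c p => by simp }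
  have hLcoe : (LinearMap.range L : Set H)
      = Set.range fun p : ℂ[X] => (aeval T p : H →L[ℂ] H) y := LinearMap.coe_range L
  refine ⟨(LinearMap.range L).topologicalClosure, Submodule.isClosed_topologicalClosure _,
    fun hbot => hy ?_, fun htop => h ?_, fun x hx => ?_⟩
  · have : y ∈ (LinearMap.range L).topologicalClosure :=
      Submodule.le_topologicalClosure _ ⟨1, by simp [L]⟩
    rwa [hbot, Submodule.mem_bot] at this
  · rw [← hLcoe]
    exact (Submodule.dense_iff_topologicalClosure_eq_top).2 htop
  · refine map_mem_closure T.continuous hx ?_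
    rintro _ ⟨p, rfl⟩
    exact ⟨X * p, by simp [L]⟩

theorem Commute.aeval_left {R A : Type*} [CommSemiring R] [Semiring A] [Algebra R A] {a b : A}
    (h : Commute a b) (p : R[X]) : Commute (aeval a p) b := by
  induction p using Polynomial.induction_on' with
  | add p q hp hq => rw [map_add]; exact hp.add_left hq
  | monomial n c =>
    rw [aeval_monomial]
    exact Commute.mul_left (Algebra.commutes c b) (h.pow_left n)

/-- Hilden's argument for Lomonosov's theorem. If `T` were not intransitive, all orbits `{p(T) y}`
with `y ≠ 0` would be dense, so finitely many polynomials `p(T)` would bring the compact set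
`closure (C '' B)`, with `B` a ball around some `x₀` far from `0`, back into `B`. Alternating `C`
with these gives elements `R (C ^ n x₀)` of `B` with `‖R‖ ≤ c ^ n`, which tend to `0` because `C` is
quasinilpotent. -/
theorem IsIntransitive.of_commute_of_spectralRadius_eq_zero {H : Type*} [NormedAddCommGroup H]
    [InnerProductSpace ℂ H] [CompleteSpace H] {T C : H →L[ℂ] H} (hTC : Commute T C)
    (hC : IsCompactOperator C) (hC0 : C ≠ 0) (hrad : spectralRadius ℂ C = 0) :
    IsIntransitive T := by
  by_contra hT
  obtain ⟨x₀, hx₀⟩ : ∃ x, C x ≠ 0 := by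
    by_contra! h
    exact hC0 (ContinuousLinearMap.ext h)
  have hCx : 0 < ‖C x₀‖ := norm_pos_iff.2 hx₀
  have hCn : 0 < ‖C‖ := norm_pos_iff.2 hC0
  have hx : 0 < ‖x₀‖ := norm_pos_iff.2 fun h => hx₀ (by rw [h, map_zero])
  -- This radius keeps both the ball around `x₀` and its image under `C` away from `0`.
  -- This radius keeps both the ball around `x₀` and its image under `C` away from `0`.
  set ρ : ℝ := ‖C x₀‖ / (2 * ‖C‖) with hρ
  have hρ0 : 0 < ρ := by positivity
  have hCρ : ‖C‖ * ρ = ‖C x₀‖ / 2 := by rw [hρ]; field_simp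
  have hρx : ρ ≤ ‖x₀‖ / 2 := by
    have h1 := C.le_opNorm x₀
    rw [hρ, div_le_iff₀ (by positivity)]
    linarith
  have hfar : ∀ y ∈ Metric.ball x₀ ρ, ‖x₀‖ / 2 ≤ ‖y‖ := by
    intro y hy
    rw [Metric.mem_ball, dist_eq_norm] at hy
    have h1 := norm_sub_norm_le x₀ y
    rw [norm_sub_rev] at h1
    linarith
  set Q : Set H := closure (C '' Metric.ball x₀ ρ) with hQ
  have hQc : IsCompact Q := hC.isCompact_closure_image_of_bounded Metric.isBounded_ball
  have hQ0 : ∀ y ∈ Q, y ≠ 0 := by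
    have hsub : Q ⊆ Metric.closedBall (C x₀) (‖C x₀‖ / 2) := by
      refine closure_minimal ?_ Metric.isClosed_closedBall
      rintro _ ⟨z, hz, rfl⟩
      rw [Metric.mem_ball, dist_eq_norm] at hz
      rw [Metric.mem_closedBall, dist_eq_norm, ← map_sub, ← hCρ]
      exact (C.le_opNorm _).trans (by gcongr)
    rintro y hy rfl
    have := hsub hy
    rw [Metric.mem_closedBall, dist_eq_norm, zero_sub, norm_neg] at this
    linarith
  obtain ⟨P, hP⟩ := hQc.elim_finite_subcover
    (fun p : ℂ[X] => (aeval T p : H →L[ℂ] H) ⁻¹' Metric.ball x₀ ρ)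
    (fun p => Metric.isOpen_ball.preimage (aeval T p : H →L[ℂ] H).continuous) (by
      intro y hy
      have hd : Dense (Set.range fun p : ℂ[X] => (aeval T p : H →L[ℂ] H) y) := by
        by_contra h
        exact hT (IsIntransitive.of_not_dense_orbit (hQ0 y hy) h)
      obtain ⟨p, hz⟩ := DenseRange.exists_mem_open hd Metric.isOpen_ball
        ⟨x₀, Metric.mem_ball_self hρ0⟩
      exact Set.mem_iUnion.2 ⟨p, hz⟩)
  set c : ℝ := 1 + ∑ p ∈ P, ‖(aeval T p : H →L[ℂ] H)‖ with hc
  have hc0 : 0 < c := by positivity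
  have hpc : ∀ p ∈ P, ‖(aeval T p : H →L[ℂ] H)‖ ≤ c := fun p hp =>
    (Finset.single_le_sum (f := fun p => ‖(aeval T p : H →L[ℂ] H)‖)
      (fun _ _ => norm_nonneg _) hp).trans (by linarith)
  have hiter : ∀ n : ℕ, ∃ R : H →L[ℂ] H, Commute R C ∧ ‖R‖ ≤ c ^ n ∧
      R ((C ^ n) x₀) ∈ Metric.ball x₀ ρ := by
    intro n
    induction n with
    | zero =>
      refine ⟨1, Commute.one_left C, ?_, by simpa using hρ0⟩
      rw [pow_zero]
      exact ContinuousLinearMap.norm_id_le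
    | succ n ih =>
      obtain ⟨R, hRC, hR, hmem⟩ := ih
      have hq : R ((C ^ (n + 1)) x₀) ∈ Q := by
        apply subset_closure
        refine ⟨R ((C ^ n) x₀), hmem, ?_⟩
        have h1 : C * (R * C ^ n) = R * C ^ (n + 1) := by
          rw [← mul_assoc, ← hRC.eq, mul_assoc, ← pow_succ']
        exact congrArg (fun f : H →L[ℂ] H => f x₀) h1
      obtain ⟨p, hp, hpm⟩ := Set.mem_iUnion₂.1 (hP hq)
      refine ⟨aeval T p * R, ?_, ?_, hpm⟩
      · exact (hTC.aeval_left p).mul_left hRC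
      · rw [pow_succ']
        exact (norm_mul_le _ _).trans (by gcongr; exact hpc p hp)
  have hlim := (tendsto_pow_mul_norm_pow_of_spectralRadius_eq_zero hrad hc0).mul_const ‖x₀‖
  rw [zero_mul] at hlim
  obtain ⟨n, hn⟩ := (hlim.eventually (gt_mem_nhds (half_pos hx))).exists
  obtain ⟨R, _, hR, hmem⟩ := hiter n
  refine absurd (hfar _ hmem) (not_le.2 (lt_of_le_of_lt ?_ hn))
  calc ‖R ((C ^ n) x₀)‖ ≤ ‖R‖ * (‖C ^ n‖ * ‖x₀‖) :=
        R.le_opNorm_of_le ((C ^ n).le_opNorm x₀)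
    _ ≤ c ^ n * (‖C ^ n‖ * ‖x₀‖) := by gcongr
    _ = _ := by ring

/-- Lomonosov's theorem for operators commuting with a nonzero compact operator `C`: an eigenspace
of `C` is invariant, and if there is none for a nonzero eigenvalue, `C` is quasinilpotent. -/
theorem IsIntransitive.of_commute_of_isCompactOperator {H : Type*} [NormedAddCommGroup H]
    [InnerProductSpace ℂ H] [CompleteSpace H] (hdim : ¬ FiniteDimensional ℂ H)
    {T C : H →L[ℂ] H} (hTC : Commute T C) (hC : IsCompactOperator C) (hC0 : C ≠ 0) :
    IsIntransitive T := by
  by_cases hrad : spectralRadius ℂ C = 0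
  · exact .of_commute_of_spectralRadius_eq_zero hTC hC hC0 hrad
  obtain ⟨μ, hμ, hμ0⟩ : ∃ μ ∈ spectrum ℂ C, μ ≠ 0 := by
    by_contra! h
    refine hrad (le_antisymm (iSup₂_le fun μ hμ => ?_) bot_le)
    simp [h μ hμ]
  have hev := (hC.hasEigenvalue_iff_mem_spectrum hμ0).2 hμ
  have hmem : ∀ x, x ∈ Module.End.eigenspace (C : Module.End ℂ H) μ ↔ C x = μ • x := fun x =>
    Module.End.mem_eigenspace_iff
  refine ⟨Module.End.eigenspace (C : Module.End ℂ H) μ, ?_, hev, fun htop => hdim ?_, ?_⟩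
  · have h1 : (Module.End.eigenspace (C : Module.End ℂ H) μ : Set H) = {x | C x = μ • x} :=
      Set.ext hmem
    rw [h1]
    exact isClosed_eq C.continuous (continuous_const_smul μ)
  · refine FiniteDimensional.of_isCompactOperator_id (𝕜 := ℂ) ?_
    have h1 : (id : H → H) = μ⁻¹ • (C : H → H) := by
      funext x
      have h2 := (hmem x).1 (by rw [htop]; trivial)
      rw [Pi.smul_apply, h2, inv_smul_smul₀ hμ0, id]
    rw [h1]
    exact hC.smul μ⁻¹
  · intro x hx
    rw [hmem] at hx ⊢
    have h1 : C (T x) = T (C x) := congrArg (fun f : H →L[ℂ] H => f x) hTC.eq.symm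
    rw [h1, hx, map_smul]

theorem IsIntransitive.of_isNilpotent {H : Type*} [NormedAddCommGroup H] [InnerProductSpace ℂ H]
    (hdim : ¬ FiniteDimensional ℂ H) {T : H →L[ℂ] H} (hT : IsNilpotent T) :
    IsIntransitive T := by
  by_cases hT0 : T = 0
  · obtain ⟨x, hx⟩ : ∃ x : H, x ≠ 0 := by
      by_contra! h
      have : Subsingleton H := ⟨fun a b => by rw [h a, h b]⟩
      exact hdim inferInstance
    refine ⟨ℂ ∙ x, Submodule.closed_of_finiteDimensional _, by simpa using hx,
      fun htop => hdim ?_, fun y _ => by simp [hT0]⟩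
    have : FiniteDimensional ℂ (⊤ : Submodule ℂ H) := by rw [← htop]; infer_instance
    exact Module.finite_def.2 (Module.Finite.iff_fg.1 this)
  · refine ⟨LinearMap.ker (T : H →ₗ[ℂ] H), T.isClosed_ker, fun hbot => ?_, fun htop => hT0 ?_,
      fun x hx => ?_⟩
    · have hinj : Function.Injective T := LinearMap.ker_eq_bot.1 hbot
      obtain ⟨k, hk⟩ := hT
      apply hT0
      ext x
      apply hinj.iterate k
      have h1 : ∀ y, T^[k] y = 0 := fun y => by
        rw [← FunLike.coe_pow_eq_iterate, hk]; rfl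
      rw [h1, h1]
    · ext x
      have : x ∈ LinearMap.ker (T : H →ₗ[ℂ] H) := by rw [htop]; trivial
      exact this
    · have h1 : T x = 0 := hx
      simp [h1]

theorem theoremB {H : Type*} [NormedAddCommGroup H] [InnerProductSpace ℂ H] [CompleteSpace H]
    [TopologicalSpace.SeparableSpace H] (hdim : ¬ FiniteDimensional ℂ H)
    (T K : H →L[ℂ] H) (hK : IsCompactOperator K) (hspec : spectrum ℂ (T + K) = {0})
    (r : ℕ) (lam : ℂ) (hlam : lam ≠ 0)
    (hgrowth : (fun n : ℕ => ‖(T + K + 1) ^ n + lam • Ring.inverse (T + K + 1) ^ n‖)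
      =O[atTop] (fun n : ℕ => (n : ℝ) ^ r)) :
    (T + K) ^ (r + 4) = 0 ∧ IsPolynomiallyCompact T ∧ IsIntransitive T := by
  have hN : ∀ c : ℂ, IsUnit (1 - c • (T + K)) := by
    intro c
    rcases eq_or_ne c 0 with rfl | hc
    · simp
    have h1 : c⁻¹ ∉ spectrum ℂ (T + K) := by simpa [hspec] using hc
    convert (spectrum.notMem_iff.1 h1).smul (Units.mk0 c hc) using 1
    rw [Units.smul_mk0, smul_sub, Algebra.algebraMap_eq_smul_one, smul_inv_smul₀ hc]
  have hu : IsUnit (1 + (T + K)) := by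
    have h1 := hN (-1)
    rwa [neg_one_smul, sub_neg_eq_add] at h1
  rw [add_comm (T + K) 1] at hgrowth
  have hnil : (T + K) ^ (r + 4) = 0 := by
    rw [show r + 4 = r + 2 + 2 by rfl, pow_add, pow_add_two_eq_zero_of_isBigO hN
      (Ring.mul_inverse_cancel _ hu) (Ring.inverse_mul_cancel _ hu) hlam hgrowth, zero_mul]
  have hcpt : IsCompactOperator (T ^ (r + 4) : H →L[ℂ] H) := by
    have h1 := (isCompactOperator_add_pow_sub_pow hK T (r + 4)).neg
    rw [hnil] at h1
    rw [zero_sub] at h1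
    rw [← neg_neg (T ^ (r + 4))]
    exact h1
  refine ⟨hnil, ⟨X ^ (r + 4), pow_ne_zero _ X_ne_zero, by rwa [aeval_X_pow]⟩, ?_⟩
  by_cases h0 : T ^ (r + 4) = 0
  · exact .of_isNilpotent hdim ⟨_, h0⟩
  · exact .of_commute_of_isCompactOperator hdim (Commute.self_pow T _) hcpt h0
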